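/- Let $d\in\mathbb N$, let $\mathcal P(\mathbb R^d)$ be the set of Borel probability measures on $\mathbb R^d$ with the topology of weak convergence, $\mathcal P_2$ the set of $\mu\in\mathcal P(\mathbb R^d)$ with $\int|x|^2\,\mu(dx)<\infty$, and $\mathcal P_2^{ac}$ the set of those $\mu\in\mathcal P_2$ that are absolutely continuous with respect to the Lebesgue measure. For $\mu,\nu\in\mathcal P(\mathbb R^d)$ let $$W_2(\mu,\nu)=\Big(\inf_{\pi}\int_{\mathbb R^d\times\mathbb R^d}|x-y|^2\,\pi(dx,dy)\Big)^{1/2}\in[0,\infty],$$ the infimum being over all couplings $\pi$ of $\mu$ and $\nu$. Let $K\subset\mathcal P(\mathbb R^d)$ satisfy (H2): $K$ is closed in $\mathcal P(\mathbb R^d)$, and for all $\nu_0,\nu_1\in K$, all random variables $X_0\sim\nu_0$, $X_1\sim\nu_1$ defined on a common probability space and all $\alpha\in[0,1]$, the law of $(1-\alpha)X_0+\alpha X_1$ belongs to $K$. Assume moreover that $K\cap\mathcal P_2\neq\emptyset$. Then, for every $\mu\in\mathcal P_2^{ac}$: 1. There is a unique $\mu^K\in K$ with $W_2(\mu,\mu^K)=\inf_{\nu\in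 K}W_2(\mu,\nu)$, and $\mu^K\in\mathcal P_2$. 2. For every probability space $(\Omega,\mathcal F,\mathbb P)$ and every random variable $X^\mu:\Omega\to\mathbb R^d$ with law $\mu$, there is a random variable $X^{\mu^K}:\Omega\to\mathbb R^d$ with law $\mu^K$, unique up to $\mathbb P$-almost sure equality, such that $$\mathbb E_{\mathbb P}\big[|X^\mu-X^{\mu^K}|^2\big]\le\mathbb E_{\mathbb P}\big[|X^\mu-Y|^2\big]$$ for every random variable $Y:\Omega\to\mathbb R^d$ whose law belongs to $K$. -/

import Mathlib

open MeasureTheory ProbabilityTheory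
open scoped ENNReal

namespace ConstrainedLaw

/-- The Euclidean space `ℝ^d` (with the Euclidean norm). -/
abbrev Rd (d : ℕ) : Type := EuclideanSpace ℝ (Fin d)

/-- `μ` has a finite second moment: `∫ |x|² μ(dx) < ∞`. -/
def FiniteSecondMoment {d : ℕ} (μ : ProbabilityMeasure (Rd d)) : Prop :=
  ∫⁻ x, ‖x‖ₑ ^ 2 ∂(μ : Measure (Rd d)) < ∞

/-- `μ` has a finite second moment and is absolutely continuous with respect to the Lebesgue
measure. -/
def IsP2ac {d : ℕ} (μ : ProbabilityMeasure (Rd d)) : Prop :=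
  FiniteSecondMoment μ ∧ (μ : Measure (Rd d)) ≪ volume

/-- The couplings of `μ` and `ν`: the measures on the product with marginals `μ` and `ν`. -/
def couplings {d : ℕ} (μ ν : ProbabilityMeasure (Rd d)) : Set (Measure (Rd d × Rd d)) :=
  {π | π.map Prod.fst = (μ : Measure (Rd d)) ∧ π.map Prod.snd = (ν : Measure (Rd d))}

/-- The quadratic Wasserstein distance, with values in `[0, ∞]`. -/
noncomputable def W2 {d : ℕ} (μ ν : ProbabilityMeasure (Rd d)) : ℝ≥0∞ :=
  (⨅ π ∈ couplings μ ν, ∫⁻ p, ‖p.1 - p.2‖ₑ ^ 2 ∂π) ^ (1 / 2 : ℝ)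

/-- The distance `W₂(μ, K) = inf_{ν ∈ K} W₂(μ, ν)` from `μ` to a set `K`. -/
noncomputable def W2ToSet {d : ℕ} (μ : ProbabilityMeasure (Rd d))
    (K : Set (ProbabilityMeasure (Rd d))) : ℝ≥0∞ :=
  ⨅ ν ∈ K, W2 μ ν

/-- `ν` is a `W₂`-projection of `μ` on `K`: it belongs to `K` and minimizes `W₂(μ, ·)` over `K`. -/
def IsW2Projection {d : ℕ} (K : Set (ProbabilityMeasure (Rd d)))
    (μ ν : ProbabilityMeasure (Rd d)) : Prop :=
  ν ∈ K ∧ W2 μ ν = W2ToSet μ K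

/-- The assumption on the constraint set: `K` is closed for the weak topology (the topology that
Mathlib puts on `ProbabilityMeasure`), and whenever `X₀` and `X₁` are random variables on a common
probability space with laws in `K`, the law of `(1 - α) X₀ + α X₁` is in `K` for all `α ∈ [0, 1]`.
Only the joint law of `(X₀, X₁)` matters, so sample spaces in `Type` exhaust all of them. -/
structure ClosedConvexConstraint {d : ℕ} (K : Set (ProbabilityMeasure (Rd d))) : Prop where
  isClosed : IsClosed K
  convex : ∀ (Ω : Type) [MeasurableSpace Ω] (P : Measure Ω) [IsProbabilityMeasure P],
    ∀ ν₀ ∈ K, ∀ ν₁ ∈ K, ∀ X₀ X₁ : Ω → Rd d,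
      HasLaw X₀ (ν₀ : Measure (Rd d)) P → HasLaw X₁ (ν₁ : Measure (Rd d)) P →
        ∀ α ∈ Set.Icc (0 : ℝ) 1, ∃ ν ∈ K,
          HasLaw (fun ω => (1 - α) • X₀ ω + α • X₁ ω) (ν : Measure (Rd d)) P

/-- `Z` is at least as close to `X` in mean square as every random variable `Y` (on the same
probability space) whose law belongs to `K`. -/
def MinimizesMeanSquare {d : ℕ} (K : Set (ProbabilityMeasure (Rd d))) {Ω : Type*}
    [MeasurableSpace Ω] (P : Measure Ω) (X Z : Ω → Rd d) : Prop :=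
  ∀ ν ∈ K, ∀ Y : Ω → Rd d, HasLaw Y (ν : Measure (Rd d)) P →
    ∫⁻ ω, ‖X ω - Z ω‖ₑ ^ 2 ∂P ≤ ∫⁻ ω, ‖X ω - Y ω‖ₑ ^ 2 ∂P

end ConstrainedLaw

/-!
The constraint on `K` says that, on every probability space, the square integrable random variables
with law in `K` form a closed convex subset of `L²`: convexity is the assumption itself, and `L²`
convergence implies weak convergence of the laws. Every coupling whose first marginal is `μ` is the
law of a pair `(x, f (x, u))` under `μ ⊗ Unif[0, 1]`
(`ConstrainedLaw.exists_map_prod_unitInterval`), so the Hilbert space projection of `(x, u) ↦ x` on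
that convex set is a random variable `Y (x, u)` which realizes the smallest cost `m` among all
couplings of `μ` with a law in `K`.

The midpoint of two admissible random variables is admissible, and the parallelogram identity gives
`2 m + 𝔼 |Z - Z'|² / 2 ≤ 𝔼 |X - Z|² + 𝔼 |X - Z'|²`
(`ConstrainedLaw.ClosedConvexConstraint.two_mul_add_le`). This single inequality does the rest:

* applied to `Y (x, u)` and `Y (x, v)` with independent `u`, `v`, it shows that `Y` does not depend
  on `u`, so that the optimal plan is carried by the graph of a map `T`
  (`ConstrainedLaw.ClosedConvexConstraint.exists_optimal_map`); then `μ^K` is the law of `T`, and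
  `T ∘ X` is the optimal random variable on any probability space that carries `X` with law `μ`;
* applied to two optimal random variables, it shows that they agree almost surely;
* applied to `T` and a sequence of couplings of `μ` and `ν` whose costs tend to `m`, it shows that
  these converge to `T` in `L²`, whence `ν` is the law of `T`: the projection is unique.
-/

open unitInterval

namespace ConstrainedLaw

variable {d : ℕ} {Ω : Type*} [MeasurableSpace Ω] {P : Measure Ω}

/-! ### Laws in `K` and the mean-square cost -/

/-- The law of `Y` under `P` belongs to `K`. -/
def HasLawIn (K : Set (ProbabilityMeasure (Rd d))) (P : Measure Ω) (Y : Ω → Rd d) : Prop :=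
  ∃ ν ∈ K, HasLaw Y (ν : Measure (Rd d)) P

/-- The quadratic transport cost `𝔼 |X - Y|²`. -/
noncomputable def cost (P : Measure Ω) (X Y : Ω → Rd d) : ℝ≥0∞ :=
  ∫⁻ ω, ‖X ω - Y ω‖ₑ ^ 2 ∂P

lemma HasLawIn.aemeasurable {K : Set (ProbabilityMeasure (Rd d))} {Y : Ω → Rd d}
    (h : HasLawIn K P Y) : AEMeasurable Y P := by
  obtain ⟨ν, -, hν⟩ := h
  exact hν.aemeasurable

lemma HasLawIn.congr {K : Set (ProbabilityMeasure (Rd d))} {Y Z : Ω → Rd d}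
    (h : HasLawIn K P Y) (hZ : Z =ᵐ[P] Y) : HasLawIn K P Z := by
  obtain ⟨ν, hνK, hν⟩ := h
  exact ⟨ν, hνK, hν.congr hZ⟩

lemma measurable_enorm_sub_sq : Measurable fun p : Rd d × Rd d ↦ ‖p.1 - p.2‖ₑ ^ 2 :=
  (measurable_fst.sub measurable_snd).enorm.pow_const 2

lemma cost_eq_lintegral_map {X Y : Ω → Rd d} (hX : AEMeasurable X P) (hY : AEMeasurable Y P) :
    cost P X Y = ∫⁻ p, ‖p.1 - p.2‖ₑ ^ 2 ∂(P.map fun ω ↦ (X ω, Y ω)) := by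
  rw [lintegral_map' measurable_enorm_sub_sq.aemeasurable (hX.prodMk hY), cost]

/-- The parallelogram identity for the midpoint of `z` and `z'`. -/
lemma enorm_sub_sq_add_enorm_sub_sq (x z z' : Rd d) :
    ‖x - z‖ₑ ^ 2 + ‖x - z'‖ₑ ^ 2 =
      2 * ‖x - ((1 - (1 / 2 : ℝ)) • z + (1 / 2 : ℝ) • z')‖ₑ ^ 2 + 2⁻¹ * ‖z - z'‖ₑ ^ 2 := by
  have key : ‖x - z‖ ^ 2 + ‖x - z'‖ ^ 2 =
      2 * ‖x - ((1 - (1 / 2 : ℝ)) • z + (1 / 2 : ℝ) • z')‖ ^ 2 + 2⁻¹ * ‖z - z'‖ ^ 2 := by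
    have h := parallelogram_law_with_norm ℝ (x - z) (x - z')
    have h1 : x - z + (x - z') =
        (2 : ℝ) • (x - ((1 - (1 / 2 : ℝ)) • z + (1 / 2 : ℝ) • z')) := by module
    have h2 : x - z - (x - z') = -(z - z') := by abel
    rw [h1, h2, norm_neg, norm_smul, Real.norm_eq_abs, abs_two] at h
    nlinarith
  have h := congrArg ENNReal.ofReal key
  rw [ENNReal.ofReal_add (by positivity) (by positivity),
    ENNReal.ofReal_add (by positivity) (by positivity), ENNReal.ofReal_mul (by positivity),
    ENNReal.ofReal_mul (by positivity), ENNReal.ofReal_inv_of_pos (by positivity)] at h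
  simpa [ENNReal.ofReal_pow] using h

lemma cost_add_cost {X Z Z' : Ω → Rd d} (hX : AEMeasurable X P) (hZ : AEMeasurable Z P)
    (hZ' : AEMeasurable Z' P) :
    cost P X Z + cost P X Z' =
      2 * cost P X (fun ω ↦ (1 - (1 / 2 : ℝ)) • Z ω + (1 / 2 : ℝ) • Z' ω) +
        2⁻¹ * cost P Z Z' := by
  simp only [cost]
  have hm : AEMeasurable
      (fun ω ↦ ‖X ω - ((1 - (1 / 2 : ℝ)) • Z ω + (1 / 2 : ℝ) • Z' ω)‖ₑ ^ 2) P := by fun_prop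
  rw [← lintegral_add_left' (by fun_prop), ← lintegral_const_mul' _ _ (by simp),
    ← lintegral_const_mul' _ _ (by simp), ← lintegral_add_left' (hm.const_mul 2)]
  exact lintegral_congr fun ω ↦ enorm_sub_sq_add_enorm_sub_sq _ _ _

/-- `ClosedConvexConstraint` only mentions sample spaces in `Type`; passing to the joint law removes
this restriction. -/
lemma ClosedConvexConstraint.hasLawIn {K : Set (ProbabilityMeasure (Rd d))}
    (hK : ClosedConvexConstraint K) [IsProbabilityMeasure P] {Y Z : Ω → Rd d}
    (hY : HasLawIn K P Y) (hZ : HasLawIn K P Z) {α : ℝ} (hα : α ∈ Set.Icc (0 : ℝ) 1) :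
    HasLawIn K P (fun ω ↦ (1 - α) • Y ω + α • Z ω) := by
  obtain ⟨ν₀, h₀K, h₀⟩ := hY
  obtain ⟨ν₁, h₁K, h₁⟩ := hZ
  have hYZ : AEMeasurable (fun ω ↦ (Y ω, Z ω)) P := h₀.aemeasurable.prodMk h₁.aemeasurable
  have hjoint : HasLaw (fun ω ↦ (Y ω, Z ω)) (P.map fun ω ↦ (Y ω, Z ω)) P := ⟨hYZ, rfl⟩
  have := Measure.isProbabilityMeasure_map hYZ
  obtain ⟨ν, hνK, hν⟩ := hK.convex (Rd d × Rd d) (P.map fun ω ↦ (Y ω, Z ω)) ν₀ h₀K ν₁ h₁K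
    Prod.fst Prod.snd
    ⟨by fun_prop, by
      rw [AEMeasurable.map_map_of_aemeasurable (by fun_prop) hYZ]; exact h₀.map_eq⟩
    ⟨by fun_prop, by
      rw [AEMeasurable.map_map_of_aemeasurable (by fun_prop) hYZ]; exact h₁.map_eq⟩ α hα
  exact ⟨ν, hνK, hν.fun_comp hjoint⟩

/-! ### Representing couplings on `ℝ^d × [0, 1]` -/

/-- Every coupling with first marginal `μ` is the law of `(x, f (x, u))` under the product of `μ`
and the uniform law on `[0, 1]`. -/
lemma exists_map_prod_unitInterval (μ : ProbabilityMeasure (Rd d)) (π : Measure (Rd d × Rd d))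
    (hπ : π.map Prod.fst = μ) :
    ∃ f : Rd d × I → Rd d, Measurable f ∧
      ((μ : Measure (Rd d)).prod (volume : Measure I)).map (fun q ↦ (q.1, f q)) = π := by
  have : IsProbabilityMeasure π := by
    rw [← Measure.isProbabilityMeasure_map_iff measurable_fst.aemeasurable, hπ]; infer_instance
  obtain ⟨f, hf, hfκ⟩ := Kernel.exists_measurable_map_eq_unitInterval π.condKernel
  refine ⟨Function.uncurry f, hf, ?_⟩
  conv_rhs => rw [← π.disintegrate π.condKernel, Measure.fst, hπ]
  ext s hs
  rw [Measure.map_apply (by fun_prop) hs, Measure.prod_apply (by measurability),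
    Measure.compProd_apply hs]
  refine lintegral_congr fun x ↦ ?_
  rw [← hfκ x, Measure.map_apply (by fun_prop) (by measurability)]
  rfl

/-! ### Projection in `L²` on random variables with law in `K` -/

/-- The law of an `L²` random variable. -/
noncomputable def lawLp (P : Measure Ω) [IsProbabilityMeasure P] (Y : Lp (Rd d) 2 P) :
    ProbabilityMeasure (Rd d) :=
  ⟨P.map Y, Measure.isProbabilityMeasure_map (Lp.aestronglyMeasurable Y).aemeasurable⟩

/-- Convergence in `L²` implies weak convergence of the laws. -/
lemma continuous_lawLp (P : Measure Ω) [IsProbabilityMeasure P] :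
    Continuous (lawLp (d := d) P) := by
  refine continuous_iff_seqContinuous.2 fun Y Z hY ↦ ?_
  exact ((tendstoInMeasure_of_tendsto_Lp hY).tendstoInDistribution_of_aemeasurable
    (fun n ↦ (Lp.aestronglyMeasurable (Y n)).aemeasurable)
    (Lp.aestronglyMeasurable Z).aemeasurable).tendsto

lemma isClosed_setOf_hasLawIn {K : Set (ProbabilityMeasure (Rd d))} (hK : IsClosed K)
    (P : Measure Ω) [IsProbabilityMeasure P] :
    IsClosed {Y : Lp (Rd d) 2 P | HasLawIn K P Y} := by
  convert hK.preimage (continuous_lawLp (d := d) P) using 1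
  ext Y
  constructor
  · rintro ⟨ν, hνK, hν⟩
    have : lawLp P Y = ν := Subtype.ext hν.map_eq
    rwa [Set.mem_preimage, this]
  · exact fun h ↦ ⟨lawLp P Y, h, (Lp.aestronglyMeasurable Y).aemeasurable, rfl⟩

lemma ClosedConvexConstraint.convex_setOf_hasLawIn {K : Set (ProbabilityMeasure (Rd d))}
    (hK : ClosedConvexConstraint K) (P : Measure Ω) [IsProbabilityMeasure P] :
    Convex ℝ {Y : Lp (Rd d) 2 P | HasLawIn K P Y} := by
  intro Y hY Z hZ a b ha hb hab
  obtain rfl : a = 1 - b := by linarith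
  refine (hK.hasLawIn hY hZ ⟨hb, by linarith⟩).congr ?_
  filter_upwards [Lp.coeFn_add ((1 - b) • Y) (b • Z), Lp.coeFn_smul (1 - b) Y,
    Lp.coeFn_smul b Z] with ω h1 h2 h3
  rw [h1, Pi.add_apply, h2, h3, Pi.smul_apply, Pi.smul_apply]

lemma enorm_sub_sq_eq_cost (Y Z : Lp (Rd d) 2 P) : ‖Y - Z‖ₑ ^ 2 = cost P Y Z := by
  rw [Lp.enorm_def, eLpNorm_congr_ae (Lp.coeFn_sub Y Z),
    eLpNorm_eq_lintegral_rpow_enorm_toReal (by simp) (by simp), cost, ← ENNReal.rpow_natCast,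
    ← ENNReal.rpow_mul]
  norm_num

lemma cost_congr {X X' Y Y' : Ω → Rd d} (hX : X =ᵐ[P] X') (hY : Y =ᵐ[P] Y') :
    cost P X Y = cost P X' Y' := by
  refine lintegral_congr_ae ?_
  filter_upwards [hX, hY] with ω h1 h2
  rw [h1, h2]

lemma memLp_two_iff {Y : Ω → Rd d} (hY : AEMeasurable Y P) :
    MemLp Y 2 P ↔ ∫⁻ ω, ‖Y ω‖ₑ ^ 2 ∂P < ∞ := by
  rw [MemLp, and_iff_right hY.aestronglyMeasurable,
    eLpNorm_lt_top_iff_lintegral_rpow_enorm_lt_top (by simp) (by simp)]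
  simp

/-- Projecting in `L²` on the closed convex set of random variables with law in `K`. -/
lemma ClosedConvexConstraint.exists_minimizesMeanSquare {K : Set (ProbabilityMeasure (Rd d))}
    (hK : ClosedConvexConstraint K) [IsProbabilityMeasure P] {X Y₀ : Ω → Rd d}
    (hX : MemLp X 2 P) (hY₀ : MemLp Y₀ 2 P) (hY₀K : HasLawIn K P Y₀) :
    ∃ Y : Ω → Rd d, Measurable Y ∧ MemLp Y 2 P ∧ HasLawIn K P Y ∧
      ∀ Z, HasLawIn K P Z → cost P X Y ≤ cost P X Z := by
  obtain ⟨Y, hYK, hYmin⟩ := exists_norm_eq_iInf_of_complete_convex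
    (K := {Y : Lp (Rd d) 2 P | HasLawIn K P Y}) ⟨hY₀.toLp, hY₀K.congr hY₀.coeFn_toLp⟩
    (isClosed_setOf_hasLawIn hK.isClosed P).isComplete (hK.convex_setOf_hasLawIn P) hX.toLp
  have hYs := Lp.aestronglyMeasurable Y
  refine ⟨hYs.aemeasurable.mk Y, hYs.aemeasurable.measurable_mk,
    (Lp.memLp Y).ae_eq hYs.aemeasurable.ae_eq_mk,
    HasLawIn.congr hYK hYs.aemeasurable.ae_eq_mk.symm, fun Z hZ ↦ ?_⟩
  by_cases hfin : cost P X Z = ∞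
  · simp [hfin]
  have hZ2 : MemLp Z 2 P := by
    have h : MemLp (X - Z) 2 P :=
      (memLp_two_iff (hX.aemeasurable.sub hZ.aemeasurable)).2 (lt_top_iff_ne_top.2 hfin)
    simpa using hX.sub h
  have hle : ‖hX.toLp - Y‖ ≤ ‖hX.toLp - hZ2.toLp‖ := by
    rw [hYmin]
    exact ciInf_le
      (f := fun w : {Y : Lp (Rd d) 2 P | HasLawIn K P Y} ↦ ‖hX.toLp - (w : Lp (Rd d) 2 P)‖)
      ⟨0, by rintro _ ⟨w, rfl⟩; positivity⟩ ⟨hZ2.toLp, hZ.congr hZ2.coeFn_toLp⟩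
  calc cost P X (hYs.aemeasurable.mk Y) = ‖hX.toLp - Y‖ₑ ^ 2 := by
        rw [enorm_sub_sq_eq_cost]
        exact cost_congr hX.coeFn_toLp.symm hYs.aemeasurable.ae_eq_mk.symm
    _ ≤ ‖hX.toLp - hZ2.toLp‖ₑ ^ 2 := by
        gcongr
        simpa only [← ofReal_norm] using ENNReal.ofReal_le_ofReal hle
    _ = cost P X Z := by
        rw [enorm_sub_sq_eq_cost]
        exact cost_congr hX.coeFn_toLp hZ2.coeFn_toLp

/-! ### Optimal plans are carried by a map -/

/-- If `m` bounds the cost from below, two random variables of nearly minimal cost are close in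
mean square, because their midpoint is still admissible. -/
lemma ClosedConvexConstraint.two_mul_add_le {K : Set (ProbabilityMeasure (Rd d))}
    (hK : ClosedConvexConstraint K) [IsProbabilityMeasure P] {X Z Z' : Ω → Rd d} {m : ℝ≥0∞}
    (hm : ∀ W, HasLawIn K P W → m ≤ cost P X W) (hX : AEMeasurable X P)
    (hZ : HasLawIn K P Z) (hZ' : HasLawIn K P Z') :
    2 * m + 2⁻¹ * cost P Z Z' ≤ cost P X Z + cost P X Z' := by
  rw [cost_add_cost hX hZ.aemeasurable hZ'.aemeasurable]
  gcongr
  exact hm _ (hK.hasLawIn hZ hZ' (by norm_num))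

lemma ClosedConvexConstraint.ae_eq_of_cost_le {K : Set (ProbabilityMeasure (Rd d))}
    (hK : ClosedConvexConstraint K) [IsProbabilityMeasure P] {X Z Z' : Ω → Rd d} {m : ℝ≥0∞}
    (hm : ∀ W, HasLawIn K P W → m ≤ cost P X W) (hmtop : m ≠ ∞) (hX : AEMeasurable X P)
    (hZ : HasLawIn K P Z) (hZ' : HasLawIn K P Z')
    (hZm : cost P X Z ≤ m) (hZm' : cost P X Z' ≤ m) : Z =ᵐ[P] Z' := by
  have h := (hK.two_mul_add_le hm hX hZ hZ').trans (add_le_add hZm hZm')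
  rw [← two_mul] at h
  have h0 : cost P Z Z' = 0 := by
    have h2 : 2 * m ≠ ∞ := ENNReal.mul_ne_top (by simp) hmtop
    have : 2⁻¹ * cost P Z Z' ≤ 0 := (ENNReal.add_le_add_iff_left h2).1 (by simpa using h)
    simpa using this
  have hmeas := hZ.aemeasurable
  have hmeas' := hZ'.aemeasurable
  rw [cost, lintegral_eq_zero_iff' (by fun_prop)] at h0
  filter_upwards [h0] with ω hω
  simpa [sub_eq_zero] using hω

lemma HasLawIn.comp {Ω' : Type*} [MeasurableSpace Ω'] {Q : Measure Ω'}
    {K : Set (ProbabilityMeasure (Rd d))} {Y : Ω' → Rd d} (hY : HasLawIn K Q Y) {g : Ω → Ω'}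
    (hg : MeasurePreserving g P Q) : HasLawIn K P fun ω ↦ Y (g ω) := by
  obtain ⟨ρ, hρK, hρ⟩ := hY
  exact ⟨ρ, hρK, hρ.fun_comp hg.hasLaw⟩

lemma cost_comp {Ω' : Type*} [MeasurableSpace Ω'] {Q : Measure Ω'} {X Y : Ω' → Rd d}
    (hX : Measurable X) (hY : Measurable Y) {g : Ω → Ω'} (hg : MeasurePreserving g P Q) :
    cost P (fun ω ↦ X (g ω)) (fun ω ↦ Y (g ω)) = cost Q X Y :=
  hg.lintegral_comp (f := fun ω ↦ ‖X ω - Y ω‖ₑ ^ 2) (by fun_prop)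

/-- A lower bound for the cost of all couplings of `μ` with a law in `K` holds on every probability
space. -/
lemma le_cost_of_hasLaw {K : Set (ProbabilityMeasure (Rd d))} {μ : Measure (Rd d)} {m : ℝ≥0∞}
    (hm : ∀ π : Measure (Rd d × Rd d), π.map Prod.fst = μ → HasLawIn K π Prod.snd →
      m ≤ cost π Prod.fst Prod.snd)
    {X W : Ω → Rd d} (hX : HasLaw X μ P) (hW : HasLawIn K P W) : m ≤ cost P X W := by
  have hmW : AEMeasurable (fun ω ↦ (X ω, W ω)) P := hX.aemeasurable.prodMk hW.aemeasurable
  refine (hm (P.map fun ω ↦ (X ω, W ω)) ?_ ?_).trans_eq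
    (cost_eq_lintegral_map hX.aemeasurable hW.aemeasurable).symm
  · rw [AEMeasurable.map_map_of_aemeasurable (by fun_prop) hmW]
    exact hX.map_eq
  · obtain ⟨ρ, hρK, hρ⟩ := hW
    refine ⟨ρ, hρK, by fun_prop, ?_⟩
    rw [AEMeasurable.map_map_of_aemeasurable (by fun_prop) hmW]
    exact hρ.map_eq

/-- An optimal transport plan from `μ` to `K` exists: it is the law of `(x, Y (x, u))` with `u`
uniform on `[0, 1]` and independent of `x`. -/
lemma ClosedConvexConstraint.exists_optimal_plan {K : Set (ProbabilityMeasure (Rd d))}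
    (hK : ClosedConvexConstraint K) (hne : ∃ ν ∈ K, FiniteSecondMoment ν)
    (μ : ProbabilityMeasure (Rd d)) (hμ : FiniteSecondMoment μ) :
    ∃ Y : Rd d × I → Rd d, Measurable Y ∧ MemLp Y 2 ((μ : Measure (Rd d)).prod volume) ∧
      HasLawIn K ((μ : Measure (Rd d)).prod volume) Y ∧
      ∀ π : Measure (Rd d × Rd d), π.map Prod.fst = (μ : Measure (Rd d)) →
        HasLawIn K π Prod.snd →
          cost ((μ : Measure (Rd d)).prod volume) Prod.fst Y ≤ cost π Prod.fst Prod.snd := by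
  have hX : MemLp Prod.fst 2 ((μ : Measure (Rd d)).prod (volume : Measure I)) :=
    ((memLp_two_iff aemeasurable_id).2 hμ).comp_measurePreserving measurePreserving_fst
  obtain ⟨ν, hνK, hν⟩ := hne
  obtain ⟨Y₀, hY₀, hY₀map⟩ := exists_map_prod_unitInterval μ
    ((μ : Measure (Rd d)).prod (ν : Measure (Rd d))) measurePreserving_fst.map_eq
  have hY₀P : MeasurePreserving Y₀ ((μ : Measure (Rd d)).prod volume) (ν : Measure (Rd d)) := by
    refine ⟨hY₀, ?_⟩
    rw [← (measurePreserving_snd (μ := (μ : Measure (Rd d))) (ν := (ν : Measure (Rd d)))).map_eq,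
      ← hY₀map, Measure.map_map (by fun_prop) (by fun_prop)]
    rfl
  obtain ⟨Y, hYm, hY2, hYK, hYmin⟩ := hK.exists_minimizesMeanSquare hX
    (((memLp_two_iff aemeasurable_id).2 hν).comp_measurePreserving hY₀P)
    ⟨ν, hνK, hY₀P.hasLaw⟩
  refine ⟨Y, hYm, hY2, hYK, fun π hπ hπK ↦ ?_⟩
  obtain ⟨f, hf, hfπ⟩ := exists_map_prod_unitInterval μ π hπ
  obtain ⟨ρ, hρK, hρ⟩ := hπK
  refine (hYmin f ⟨ρ, hρK, hf.aemeasurable, ?_⟩).trans_eq ?_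
  · rw [← hρ.map_eq, ← hfπ, Measure.map_map (by fun_prop) (by fun_prop)]
    rfl
  · rw [cost_eq_lintegral_map (by fun_prop) (by fun_prop), hfπ, cost]

/-- The optimal transport plan from `μ` to `K` is carried by the graph of a map `T`. -/
lemma ClosedConvexConstraint.exists_optimal_map {K : Set (ProbabilityMeasure (Rd d))}
    (hK : ClosedConvexConstraint K) (hne : ∃ ν ∈ K, FiniteSecondMoment ν)
    (μ : ProbabilityMeasure (Rd d)) (hμ : FiniteSecondMoment μ) :
    ∃ T : Rd d → Rd d, Measurable T ∧ MemLp T 2 (μ : Measure (Rd d)) ∧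
      HasLawIn K (μ : Measure (Rd d)) T ∧
      ∀ π : Measure (Rd d × Rd d), π.map Prod.fst = (μ : Measure (Rd d)) →
        HasLawIn K π Prod.snd →
          cost (μ : Measure (Rd d)) id T ≤ cost π Prod.fst Prod.snd := by
  obtain ⟨Y, hYm, hY2, hYK, hmin⟩ := hK.exists_optimal_plan hne μ hμ
  have hfst : MeasurePreserving Prod.fst ((μ : Measure (Rd d)).prod (volume : Measure I))
    (μ : Measure (Rd d)) := measurePreserving_fst
  have hX := ((memLp_two_iff aemeasurable_id).2 hμ).comp_measurePreserving hfst
  have hfin : cost ((μ : Measure (Rd d)).prod volume) Prod.fst Y ≠ ∞ :=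
    ((memLp_two_iff (hX.sub hY2).aemeasurable).1 (hX.sub hY2)).ne
  -- two copies of `Y` which share `x` and use independent randomness `u`, `v` must agree
  have hp : MeasurePreserving (fun q : I × Rd d × I ↦ q.2)
      ((volume : Measure I).prod ((μ : Measure (Rd d)).prod volume))
      ((μ : Measure (Rd d)).prod volume) := measurePreserving_snd
  have hp' : MeasurePreserving (fun q : I × Rd d × I ↦ (q.2.1, q.1))
      ((volume : Measure I).prod ((μ : Measure (Rd d)).prod volume))
      ((μ : Measure (Rd d)).prod volume) :=
    Measure.measurePreserving_swap.comp ((MeasurePreserving.id volume).prod hfst)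
  have hX₁ : HasLaw (fun q : I × Rd d × I ↦ q.2.1) (μ : Measure (Rd d))
      ((volume : Measure I).prod ((μ : Measure (Rd d)).prod volume)) :=
    (hfst.comp hp).hasLaw
  have hcostp := cost_comp measurable_fst hYm hp
  have hcostp' := cost_comp measurable_fst hYm hp'
  have hagree : (fun q : I × Rd d × I ↦ Y (q.2.1, q.1))
      =ᵐ[(volume : Measure I).prod ((μ : Measure (Rd d)).prod volume)] fun q ↦ Y q.2 :=
    hK.ae_eq_of_cost_le (fun W hW ↦ le_cost_of_hasLaw hmin hX₁ hW) hfin hX₁.aemeasurable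
      (hYK.comp hp') (hYK.comp hp) hcostp'.le hcostp.le
  obtain ⟨u, hu⟩ := (Measure.ae_ae_of_ae_prod hagree).exists
  have hT : Measurable fun x ↦ Y (x, u) := by fun_prop
  have hTY : (fun q : Rd d × I ↦ Y (q.1, u)) =ᵐ[(μ : Measure (Rd d)).prod volume] Y := hu
  have hcost : cost (μ : Measure (Rd d)) id (fun x ↦ Y (x, u)) =
      cost ((μ : Measure (Rd d)).prod volume) Prod.fst Y :=
    (cost_comp measurable_id hT hfst).symm.trans (cost_congr .rfl hTY)
  refine ⟨fun x ↦ Y (x, u), hT, ?_, ?_, fun π hπ hπK ↦ hcost.trans_le (hmin π hπ hπK)⟩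
  · rw [← hfst.map_eq, memLp_map_measure_iff hT.aestronglyMeasurable (by fun_prop)]
    exact (memLp_congr_ae hTY).2 hY2
  · obtain ⟨ρ, hρK, hρ⟩ := hYK
    refine ⟨ρ, hρK, by fun_prop, ?_⟩
    rw [← hfst.map_eq, Measure.map_map hT (by fun_prop)]
    exact (hρ.congr hTY).map_eq

/-! ### Uniqueness of the Wasserstein projection -/

/-- If couplings of `μ` and `ν` come arbitrarily close in cost to the optimal map `T`, then they
converge in mean square to `T`, so that `ν` is the law of `T`. -/
lemma ClosedConvexConstraint.hasLaw_of_iInf_eq {K : Set (ProbabilityMeasure (Rd d))}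
    (hK : ClosedConvexConstraint K) {μ ν : ProbabilityMeasure (Rd d)}
    (hμ : FiniteSecondMoment μ) (hν : ν ∈ K) {T : Rd d → Rd d} (hTm : Measurable T)
    (hT2 : MemLp T 2 (μ : Measure (Rd d))) (hTK : HasLawIn K (μ : Measure (Rd d)) T)
    (hTmin : ∀ π : Measure (Rd d × Rd d), π.map Prod.fst = (μ : Measure (Rd d)) →
      HasLawIn K π Prod.snd → cost (μ : Measure (Rd d)) id T ≤ cost π Prod.fst Prod.snd)
    (hinf : ⨅ π ∈ couplings μ ν, cost π Prod.fst Prod.snd = cost (μ : Measure (Rd d)) id T) :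
    HasLaw T (ν : Measure (Rd d)) (μ : Measure (Rd d)) := by
  set m := cost (μ : Measure (Rd d)) id T
  set P₀ : Measure (Rd d × I) := (μ : Measure (Rd d)).prod volume
  have hid : MemLp id 2 (μ : Measure (Rd d)) := (memLp_two_iff aemeasurable_id).2 hμ
  have hfst : MeasurePreserving Prod.fst P₀ (μ : Measure (Rd d)) := measurePreserving_fst
  have hX : MemLp Prod.fst 2 P₀ := hid.comp_measurePreserving hfst
  have hT2' : MemLp (fun q : Rd d × I ↦ T q.1) 2 P₀ := hT2.comp_measurePreserving hfst
  have hTK' : HasLawIn K P₀ (fun q : Rd d × I ↦ T q.1) := hTK.comp hfst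
  have hmT : cost P₀ Prod.fst (fun q ↦ T q.1) = m := cost_comp measurable_id hTm hfst
  have hfin : m ≠ ∞ := ((memLp_two_iff (hid.sub hT2).aemeasurable).1 (hid.sub hT2)).ne
  have hlow (W : Rd d × I → Rd d) (hW : HasLawIn K P₀ W) : m ≤ cost P₀ Prod.fst W :=
    le_cost_of_hasLaw hTmin hfst.hasLaw hW
  have happrox (ε : ℝ≥0∞) (hε : 0 < ε) : ∃ Y : Lp (Rd d) 2 P₀,
      HasLawIn {ν} P₀ Y ∧ edist Y hT2'.toLp < ε := by
    obtain ⟨δ, hδ, hδε⟩ : ∃ δ : ℝ≥0∞, 0 < δ ∧ 2 * δ < ε ^ 2 := by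
      obtain ⟨δ, hδ, h⟩ := exists_between
        (ENNReal.div_pos (pow_ne_zero 2 hε.ne') (by simp : (2 : ℝ≥0∞) ≠ ∞))
      refine ⟨δ, hδ, ?_⟩
      rw [mul_comm]
      exact (ENNReal.lt_div_iff_mul_lt (by simp) (by simp)).1 h
    have hlt : ⨅ π ∈ couplings μ ν, cost π Prod.fst Prod.snd < m + δ := by
      rw [hinf]
      exact ENNReal.lt_add_right hfin hδ.ne'
    obtain ⟨π, hπ⟩ := iInf_lt_iff.1 hlt
    obtain ⟨⟨hπ1, hπ2⟩, hπm⟩ := iInf_lt_iff.1 hπ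
    obtain ⟨f, hf, hfπ⟩ := exists_map_prod_unitInterval μ π hπ1
    have hfcost : cost P₀ Prod.fst f < m + δ := by
      rwa [cost_eq_lintegral_map (by fun_prop) (by fun_prop), hfπ]
    have hf2 : MemLp f 2 P₀ := by
      have h : MemLp (Prod.fst - f) 2 P₀ :=
        (memLp_two_iff (by fun_prop)).2 (hfcost.trans_le le_top)
      simpa using hX.sub h
    have hfν : HasLaw f (ν : Measure (Rd d)) P₀ := by
      refine ⟨by fun_prop, ?_⟩
      rw [← hπ2, ← hfπ, Measure.map_map (by fun_prop) (by fun_prop)]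
      rfl
    refine ⟨hf2.toLp, HasLawIn.congr ⟨ν, rfl, hfν⟩ hf2.coeFn_toLp, ?_⟩
    have hgap : 2⁻¹ * cost P₀ f (fun q ↦ T q.1) ≤ δ := by
      have h := (hK.two_mul_add_le hlow (by fun_prop) ⟨ν, hν, hfν⟩ hTK').trans
        (add_le_add hfcost.le hmT.le)
      rw [show m + δ + m = 2 * m + δ by ring] at h
      exact (ENNReal.add_le_add_iff_left (ENNReal.mul_ne_top (by simp) hfin)).1 h
    have hsq : ‖hf2.toLp - hT2'.toLp‖ₑ ^ 2 < ε ^ 2 := by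
      rw [enorm_sub_sq_eq_cost, cost_congr hf2.coeFn_toLp hT2'.coeFn_toLp]
      refine lt_of_le_of_lt ?_ hδε
      rwa [ENNReal.inv_mul_le_iff (by simp) (by simp)] at hgap
    rw [edist_eq_enorm_sub]
    exact lt_of_not_ge fun h ↦ hsq.not_ge (by gcongr)
  have hmem : hT2'.toLp ∈ {Y : Lp (Rd d) 2 P₀ | HasLawIn {ν} P₀ Y} := by
    rw [← (isClosed_setOf_hasLawIn (isClosed_singleton (x := ν)) P₀).closure_eq,
      EMetric.mem_closure_iff]
    intro ε hε
    obtain ⟨Y, hY, hYε⟩ := happrox ε hε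
    exact ⟨Y, hY, by rwa [edist_comm]⟩
  obtain ⟨ρ, rfl, hρ⟩ := HasLawIn.congr hmem hT2'.coeFn_toLp.symm
  refine ⟨by fun_prop, ?_⟩
  rw [← hfst.map_eq, Measure.map_map hTm (by fun_prop)]
  exact hρ.map_eq

end ConstrainedLaw

theorem lemma2p2 (d : ℕ)
    (K : Set (ProbabilityMeasure (ConstrainedLaw.Rd d)))
    (hK : ConstrainedLaw.ClosedConvexConstraint K)
    (hne : ∃ ν ∈ K, ConstrainedLaw.FiniteSecondMoment ν)
    (μ : ProbabilityMeasure (ConstrainedLaw.Rd d)) (hμ : ConstrainedLaw.IsP2ac μ) :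
    ∃ μK : ProbabilityMeasure (ConstrainedLaw.Rd d),
      ConstrainedLaw.FiniteSecondMoment μK ∧
      ConstrainedLaw.IsW2Projection K μ μK ∧
      (∀ ν : ProbabilityMeasure (ConstrainedLaw.Rd d),
        ConstrainedLaw.IsW2Projection K μ ν → ν = μK) ∧
      ∀ (Ω : Type*) [MeasurableSpace Ω] (P : Measure Ω) [IsProbabilityMeasure P]
        (X : Ω → ConstrainedLaw.Rd d),
        HasLaw X (μ : Measure (ConstrainedLaw.Rd d)) P →
          ∃ Z : Ω → ConstrainedLaw.Rd d,
            Measurable Z ∧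
            HasLaw Z (μK : Measure (ConstrainedLaw.Rd d)) P ∧
            ConstrainedLaw.MinimizesMeanSquare K P X Z ∧
            ∀ Z' : Ω → ConstrainedLaw.Rd d,
              HasLaw Z' (μK : Measure (ConstrainedLaw.Rd d)) P →
              ConstrainedLaw.MinimizesMeanSquare K P X Z' → Z' =ᵐ[P] Z := by
  open ConstrainedLaw in
  obtain ⟨T, hTm, hT2, hTK, hTmin⟩ := hK.exists_optimal_map hne μ hμ.1
  obtain ⟨μK, hμK, hT⟩ := id hTK
  have hid : MemLp id 2 (μ : Measure (Rd d)) := (memLp_two_iff aemeasurable_id).2 hμ.1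
  have hfin : cost (μ : Measure (Rd d)) id T ≠ ∞ :=
    ((memLp_two_iff (hid.sub hT2).aemeasurable).1 (hid.sub hT2)).ne
  have hlow (ν : ProbabilityMeasure (Rd d)) (hν : ν ∈ K) :
      cost (μ : Measure (Rd d)) id T ≤ ⨅ π ∈ couplings μ ν, cost π Prod.fst Prod.snd :=
    le_iInf₂ fun π hπ ↦ hTmin π hπ.1 ⟨ν, hν, by fun_prop, hπ.2⟩
  have hinf : ⨅ π ∈ couplings μ μK, cost π Prod.fst Prod.snd =
      cost (μ : Measure (Rd d)) id T := by
    refine le_antisymm ?_ (hlow μK hμK)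
    refine (iInf₂_le ((μ : Measure (Rd d)).map fun x ↦ (x, T x)) ⟨?_, ?_⟩).trans_eq
      (cost_eq_lintegral_map aemeasurable_id hTm.aemeasurable).symm
    · rw [Measure.map_map (by fun_prop) (by fun_prop)]
      exact Measure.map_id
    · rw [Measure.map_map (by fun_prop) (by fun_prop)]
      exact hT.map_eq
  have hdist : W2ToSet μ K = W2 μ μK :=
    le_antisymm (iInf₂_le μK hμK) <| le_iInf₂ fun ν hν ↦
      ENNReal.rpow_le_rpow (hinf.trans_le (hlow ν hν)) (by norm_num)
  refine ⟨μK, ?_, ⟨hμK, hdist.symm⟩, ?_, ?_⟩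
  · rw [FiniteSecondMoment, ← hT.map_eq, lintegral_map (by fun_prop) hTm]
    exact (memLp_two_iff hTm.aemeasurable).1 hT2
  · rintro ν ⟨hνK, hν⟩
    have hνinf : ⨅ π ∈ couplings μ ν, cost π Prod.fst Prod.snd =
        cost (μ : Measure (Rd d)) id T := by
      rw [← hinf]
      exact ENNReal.rpow_left_injective (x := 1 / 2) (by norm_num) (hν.trans hdist)
    exact Subtype.ext <|
      (hK.hasLaw_of_iInf_eq hμ.1 hνK hTm hT2 hTK hTmin hνinf).map_eq.symm.trans hT.map_eq
  · intro Ω _ P _ X hX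
    have hle (W : Ω → Rd d) (hW : HasLawIn K P W) :
        cost (μ : Measure (Rd d)) id T ≤ cost P X W := le_cost_of_hasLaw hTmin hX hW
    -- `X` is only a.e. measurable, but `Z` has to be measurable
    set X' := hX.aemeasurable.mk X
    have hXX' : X =ᵐ[P] X' := hX.aemeasurable.ae_eq_mk
    have hX'P : MeasurePreserving X' P (μ : Measure (Rd d)) :=
      (hX.congr hXX'.symm).measurePreserving hX.aemeasurable.measurable_mk
    have hZ : HasLaw (fun ω ↦ T (X' ω)) (μK : Measure (Rd d)) P := hT.fun_comp hX'P.hasLaw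
    have hcost : cost P X (fun ω ↦ T (X' ω)) = cost (μ : Measure (Rd d)) id T :=
      (cost_congr hXX' .rfl).trans (cost_comp measurable_id hTm hX'P)
    exact ⟨fun ω ↦ T (X' ω), hTm.comp hX'P.measurable, hZ,
      fun ν hν Y hY ↦ hcost.trans_le (hle Y ⟨ν, hν, hY⟩),
      fun Z' hZ' hmin ↦ hK.ae_eq_of_cost_le hle hfin hX.aemeasurable ⟨μK, hμK, hZ'⟩
        ⟨μK, hμK, hZ⟩ ((hmin μK hμK _ hZ).trans hcost.le) hcost.le⟩
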